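/- Let $X$ be a set of inputs, let $f(\theta;x)$ be a real-valued model with parameters $\theta\in\mathbb{R}^D$ and inputs $x\in X$, and let $L\in\mathbb{R}$. Assume that for every $x\in X$ the function $\theta\mapsto f(\theta;x)$ is $\mathcal{C}^2$ on $\mathbb{R}^D$ and $L$-homogeneous, i.e. $f(c\theta;x)=c^Lf(\theta;x)$ for all $c>0$ and all $\theta$. Let $(x_1,y_1),\dots,(x_n,y_n)\in X\times\mathbb{R}$ with $n\ge 1$, and let $\bar\theta_{\mathrm{init}}\in\mathbb{R}^D$ satisfy $f(\bar\theta_{\mathrm{init}};x)=0$ for all $x\in X$. Assume that the NTK features $\nabla f(\bar\theta_{\mathrm{init}};x_i)$, $i=1,\dots,n$ (gradients with respect to $\theta$), are linearly independent. Let $\lambda(\alpha)>0$ for $\alpha>0$, with $\lambda(\alpha)=\Theta(\alpha^{-p})$ as $\alpha\to+\infty$ for some constant $p>0$. For $\lambda>0$ put $$\mathcal{L}_{\lambda}(\theta)=\frac1n\sum_{i=1}^n\bigl(f(\theta;x_i)-y_i\bigr)^2+\frac{\lambda}{2}\|\theta\|_2^2 .$$ Then: 1. The problem of minimizing $\frac12\|h\|_2^2$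 over $h\in\mathbb{R}^D$ subject to $\langle\nabla f(\bar\theta_{\mathrm{init}};x_i),h\rangle=y_i$ for all $i$ has a unique solution $h^*_{\mathrm{ntk}}$. 2. For every $\alpha>0$ the gradient flow $\frac{\mathrm d\theta}{\mathrm dt}=-\nabla\mathcal{L}_{\lambda(\alpha)}(\theta)$ with $\theta(0)=\alpha\bar\theta_{\mathrm{init}}$ has a solution on $[0,\infty)$. 3. Let $\theta(t;\alpha\bar\theta_{\mathrm{init}})$ denote any such solution. For every constant $c\in(0,1)$, with $T_c^-(\alpha):=\frac{1-c}{\lambda(\alpha)}\log\alpha$, for every $x\in X$, $$\lim_{\alpha\to+\infty} f\bigl(\theta(T_c^-(\alpha);\alpha\bar\theta_{\mathrm{init}});x\bigr)=\bigl\langle\nabla f(\bar\theta_{\mathrm{init}};x),h^*_{\mathrm{ntk}}\bigr\rangle .$$ -/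

import Mathlib

open Filter Topology Asymptotics

noncomputable section

/-- Squared loss `ℓ(ŷ; y) = (ŷ - y)²`. -/
def squaredLoss (yhat y : ℝ) : ℝ := (yhat - y) ^ 2

/-- Training loss `𝓛(θ) = (1/n) ∑ᵢ ℓ(f(θ; xᵢ); yᵢ)` for the squared loss. -/
def trainLoss {D n : ℕ} {X : Type*} (f : EuclideanSpace ℝ (Fin D) → X → ℝ)
    (x : Fin n → X) (y : Fin n → ℝ) (θ : EuclideanSpace ℝ (Fin D)) : ℝ :=
  (1 / (n : ℝ)) * ∑ i, squaredLoss (f θ (x i)) (y i)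

/-- Training loss with weight decay `𝓛_lam(θ) = 𝓛(θ) + (lam/2) ‖θ‖²`. -/
def regLoss {D n : ℕ} {X : Type*} (f : EuclideanSpace ℝ (Fin D) → X → ℝ)
    (x : Fin n → X) (y : Fin n → ℝ) (lam : ℝ) (θ : EuclideanSpace ℝ (Fin D)) : ℝ :=
  trainLoss f x y θ + lam / 2 * ‖θ‖ ^ 2

/-- The model is `L`-homogeneous in its parameters: `f(c θ; x) = c ^ L f(θ; x)` for `c > 0`. -/
def IsHomogeneousModel {D : ℕ} {X : Type*} (f : EuclideanSpace ℝ (Fin D) → X → ℝ)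
    (L : ℝ) : Prop :=
  ∀ (x : X) (c : ℝ), 0 < c → ∀ θ : EuclideanSpace ℝ (Fin D), f (c • θ) x = c ^ L * f θ x

/-- NTK feature `∇f(θ; x)` of the input `x`: the gradient in the parameters at `θ`. -/
def ntkFeature {D : ℕ} {X : Type*} (f : EuclideanSpace ℝ (Fin D) → X → ℝ)
    (θ : EuclideanSpace ℝ (Fin D)) (x : X) : EuclideanSpace ℝ (Fin D) :=
  gradient (fun ϑ => f ϑ x) θ

/-- `θ` solves `dθ/dt = -∇F(θ)` on `[0, ∞)` with `θ(0) = θ₀`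
(the derivative is one-sided at time `0` and two-sided at positive times). -/
def IsGradientFlow {D : ℕ} (F : EuclideanSpace ℝ (Fin D) → ℝ)
    (θ₀ : EuclideanSpace ℝ (Fin D)) (θ : ℝ → EuclideanSpace ℝ (Fin D)) : Prop :=
  θ 0 = θ₀ ∧ ∀ t : ℝ, 0 ≤ t → HasDerivWithinAt θ (-gradient F (θ t)) (Set.Ici 0) t

/-- `h` solves: minimize `½ ‖h‖²` subject to `⟨g i, h⟩ = y i` for all `i`. -/
def IsMinNormInterpolant {D n : ℕ} (g : Fin n → EuclideanSpace ℝ (Fin D))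
    (y : Fin n → ℝ) (h : EuclideanSpace ℝ (Fin D)) : Prop :=
  (∀ i, inner ℝ (g i) h = y i) ∧
    ∀ h' : EuclideanSpace ℝ (Fin D), (∀ i, inner ℝ (g i) h' = y i) →
      1 / 2 * ‖h‖ ^ 2 ≤ 1 / 2 * ‖h'‖ ^ 2

end

/-!
Weight decay alone multiplies the parameters by `exp (-lam t)`. Dividing the flow by
`b = α exp (-lam t)` leaves, by homogeneity, a flow `φ` driven only by the data, with
`φ' = -μ b ^ (2 L - 2) J(φ)† s`, where `s = G φ - b ^ (-L) y` is the rescaled residual of the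
output map `G` and `J` its derivative. The dissipation of `s` is proportional to the speed of `φ`,
and the source of `s` is the derivative of `b ^ (-L) y`, so `‖φ - θ₀‖ + C ‖s‖ ≤ C b ^ (-L) ‖y‖`.
Hence `φ` stays near `θ₀`, where the tangent kernel is nondegenerate, as long as `b` is large;
at the time in the theorem `b = α ^ c`.

The displacement `b ^ L (φ - θ₀)` is therefore bounded, and it determines the outputs to first
order, since every output vanishes at `θ₀`. The training outputs converge to `y` because the
kernel dominates a weight decay that tends to zero. The component of the displacement in
`ker J(θ₀)` obeys the same movement bound with `P J(φ)†` in place of `J(φ)†`, where `P` is the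
projection onto the kernel, and `P J(θ₀)† = 0`. So the displacement converges to the interpolant
orthogonal to `ker J(θ₀)`, the one of least norm.
-/

section GradientFlow

open Manifold in
theorem exists_hasDerivAt_eq_of_lipschitzWith {E : Type*} [NormedAddCommGroup E] [NormedSpace ℝ E]
    [CompleteSpace E] {v : E → E} {K : NNReal} (hv : ContDiff ℝ 1 v) (hK : LipschitzWith K v)
    (z : E) : ∃ γ : ℝ → E, γ 0 = z ∧ ∀ t, HasDerivAt γ (v (γ t)) t := by
  -- With radius `‖v z‖ + 1` the existence time of Picard-Lindelöf does not depend on `z`.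
  have hlocal (z : E) : ∃ γ : ℝ → E, γ 0 = z ∧
      ∀ t ∈ Set.Ioo (-(1 + K : ℝ)⁻¹) (1 + K : ℝ)⁻¹, HasDerivAt γ (v (γ t)) t := by
    have hmem : (0 : ℝ) ∈ Set.Icc (-(1 + K : ℝ)⁻¹) (1 + K : ℝ)⁻¹ :=
      ⟨neg_nonpos.2 (by positivity), by positivity⟩
    have hpl : IsPicardLindelof (fun _ => v) ⟨0, hmem⟩ z (‖v z‖₊ + 1) 0
        ((1 + K) * (‖v z‖₊ + 1)) K :=
      { lipschitzOnWith := fun _ _ => hK.lipschitzOnWith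
        continuousOn := fun _ _ => continuousOn_const
        norm_le := fun _ _ w hw => by
          have hwz : ‖v w - v z‖ ≤ K * (‖v z‖ + 1) :=
            (hK.norm_sub_le w z).trans (by gcongr; simpa [dist_eq_norm] using hw)
          push_cast
          linarith [norm_le_norm_add_norm_sub' (v w) (v z)]
        mul_max_le := by
          push_cast
          rw [sub_zero, zero_sub, neg_neg, max_self]
          exact (by field_simp; simp : _ = _).le }
    obtain ⟨γ, hγz, hγ⟩ := hpl.exists_eq_forall_mem_Icc_hasDerivWithinAt₀
    exact ⟨γ, hγz, fun t ht =>
      (hγ t (Set.Ioo_subset_Icc_self ht)).hasDerivAt (Icc_mem_nhds ht.1 ht.2)⟩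
  obtain ⟨γ, hγz, hγ⟩ := exists_isMIntegralCurve_of_isMIntegralCurveOn (I := 𝓘(ℝ, E)) (v := v)
    (contMDiff_vectorSpace_iff_contDiff.2 hv) (ε := (1 + K : ℝ)⁻¹) (by positivity)
    (fun z => (hlocal z).imp fun γ hγ => ⟨hγ.1, fun t ht =>
      (hγ.2 t ht).hasFDerivAt.hasMFDerivAt.hasMFDerivWithinAt⟩) z
  exact ⟨γ, hγz, fun t => hasDerivAt_iff_hasFDerivAt.2 (hγ t).hasFDerivAt⟩

theorem antitone_comp_of_hasDerivAt_eq_smul_neg_gradient {E : Type*} [NormedAddCommGroup E]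
    [InnerProductSpace ℝ E] [CompleteSpace E] {F χ : E → ℝ} {γ : ℝ → E} (hF : Differentiable ℝ F)
    (hχ : ∀ z, 0 ≤ χ z) (hγ : ∀ t, HasDerivAt γ (χ (γ t) • -gradient F (γ t)) t) :
    Antitone (F ∘ γ) := by
  have hderiv (t : ℝ) : HasDerivAt (F ∘ γ) (-(χ (γ t) * ‖gradient F (γ t)‖ ^ 2)) t := by
    refine ((hF (γ t)).hasGradientAt.hasFDerivAt.comp_hasDerivAt t (hγ t)).congr_deriv ?_
    rw [InnerProductSpace.toDual_apply_apply, inner_smul_right, inner_neg_right,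
      real_inner_self_eq_norm_sq, mul_neg]
  refine antitone_of_deriv_nonpos (fun t => (hderiv t).differentiableAt) fun t => ?_
  rw [(hderiv t).deriv]
  exact neg_nonpos.2 (mul_nonneg (hχ _) (sq_nonneg _))

/-- Cutting the gradient off outside the sublevel set makes it globally Lipschitz, and the flow of
the cut-off field never leaves the sublevel set. -/
theorem exists_isGradientFlow_of_isBounded {D : ℕ} {F : EuclideanSpace ℝ (Fin D) → ℝ}
    (hF : ContDiff ℝ 2 F) {θ₀ : EuclideanSpace ℝ (Fin D)}
    (hbdd : Bornology.IsBounded {z | F z ≤ F θ₀}) : ∃ θ, IsGradientFlow F θ₀ θ := by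
  obtain ⟨R, hR, hsub⟩ := hbdd.subset_closedBall_lt 0 0
  have hgrad : ContDiff ℝ 1 (gradient F) :=
    (InnerProductSpace.toDual ℝ _).symm.toContinuousLinearEquiv.contDiff.comp
      (hF.fderiv_right (m := 1) (by norm_num))
  let χ : ContDiffBump (0 : EuclideanSpace ℝ (Fin D)) := ⟨R, R + 1, hR, lt_add_one R⟩
  have hv : ContDiff ℝ 1 fun z => χ z • -gradient F z := χ.contDiff.smul hgrad.neg
  obtain ⟨K, hK⟩ := hv.lipschitzWith_of_hasCompactSupport χ.hasCompactSupport.smul_right one_ne_zero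
  obtain ⟨θ, hθ₀, hθ⟩ := exists_hasDerivAt_eq_of_lipschitzWith hv hK θ₀
  refine ⟨θ, hθ₀, fun t ht => ?_⟩
  have hanti : Antitone (F ∘ θ) := antitone_comp_of_hasDerivAt_eq_smul_neg_gradient
    (hF.differentiable two_ne_zero) (χ := χ) (fun _ => χ.nonneg) hθ
  have hle : F (θ t) ≤ F θ₀ := (hanti ht).trans_eq (congrArg F hθ₀)
  have hone : χ (θ t) = 1 := χ.one_of_mem_closedBall (hsub hle)
  simpa only [hone, one_smul] using (hθ t).hasDerivWithinAt (s := Set.Ici 0)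

end GradientFlow

section Dissipation

variable {E : Type*} [NormedAddCommGroup E] [InnerProductSpace ℝ E]

theorem hasDerivWithinAt_norm {u : ℝ → E} {u' : E} {s : Set ℝ} {t : ℝ}
    (hu : HasDerivWithinAt u u' s t) (h0 : u t ≠ 0) :
    HasDerivWithinAt (fun τ => ‖u τ‖) (inner ℝ (u t) u' / ‖u t‖) s t := by
  have hsqrt := hu.norm_sq.sqrt (pow_ne_zero 2 (norm_ne_zero_iff.2 h0))
  simp only [Real.sqrt_sq (norm_nonneg _)] at hsqrt
  exact hsqrt.congr_deriv (mul_div_mul_left _ _ two_ne_zero)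

theorem eventually_slope_norm_lt_of_dissipative {u : ℝ → E} {A : E →L[ℝ] E} {w : E} {q r t : ℝ}
    (hu : HasDerivWithinAt u (w - A (u t)) (Set.Ici t) t)
    (hA : q * ‖u t‖ ^ 2 ≤ inner ℝ (u t) (A (u t))) (hr : ‖w‖ - q * ‖u t‖ < r) :
    ∀ᶠ z in 𝓝[>] t, slope (fun τ => ‖u τ‖) t z < r := by
  by_cases h0 : u t = 0
  · simp only [h0, map_zero, sub_zero, norm_zero, mul_zero] at hu hr
    filter_upwards [hu.Ioi_of_Ici.limsup_slope_norm_le hr, self_mem_nhdsWithin] with z hz htz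
    rwa [slope_def_module, smul_eq_mul, ← Real.norm_of_nonneg (sub_nonneg.2 (le_of_lt htz))]
  · refine ((hasDerivWithinAt_norm hu h0).Ioi_of_Ici.limsup_slope_le' (lt_irrefl t) ?_)
    have hpos : 0 < ‖u t‖ := norm_pos_iff.2 h0
    refine lt_of_le_of_lt ((div_le_iff₀ hpos).2 ?_) hr
    rw [inner_sub_right]
    linarith [real_inner_le_norm (u t) w]

theorem norm_sub_add_mul_norm_le_of_dissipative {F : Type*} [NormedAddCommGroup F]
    [InnerProductSpace ℝ F] {ψ ψ' : ℝ → F} {u w : ℝ → E} {A : ℝ → E →L[ℝ] E} {q B B' : ℝ → ℝ}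
    {a b C : ℝ} (hC : 0 ≤ C) (hψc : ContinuousOn ψ (Set.Icc a b))
    (hψ : ∀ t ∈ Set.Ico a b, HasDerivWithinAt ψ (ψ' t) (Set.Ici t) t)
    (huc : ContinuousOn u (Set.Icc a b))
    (hu : ∀ t ∈ Set.Ico a b, HasDerivWithinAt u (w t - A t (u t)) (Set.Ici t) t)
    (hBc : ContinuousOn B (Set.Icc a b))
    (hB : ∀ t ∈ Set.Ico a b, HasDerivWithinAt B (B' t) (Set.Ici t) t)
    (hA : ∀ t ∈ Set.Ico a b, q t * ‖u t‖ ^ 2 ≤ inner ℝ (u t) (A t (u t)))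
    (hψ' : ∀ t ∈ Set.Ico a b, ‖ψ' t‖ ≤ C * (q t * ‖u t‖))
    (hw : ∀ t ∈ Set.Ico a b, ‖w t‖ ≤ B' t) (ha : ‖u a‖ ≤ B a) {t : ℝ} (ht : t ∈ Set.Icc a b) :
    ‖ψ t - ψ a‖ + C * ‖u t‖ ≤ C * B t := by
  refine image_le_of_liminf_slope_right_le_deriv_boundary
    (f := fun t => ‖ψ t - ψ a‖ + C * ‖u t‖)
    ((hψc.sub continuousOn_const).norm.add (continuousOn_const.mul huc.norm))
    (by simpa using mul_le_mul_of_nonneg_left ha hC) (continuousOn_const.mul hBc)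
    (fun t ht => (hB t ht).const_mul C) (fun t ht r hr => Eventually.frequently ?_) ht
  obtain ⟨δ, hδ, hrδ⟩ : ∃ δ > 0, C * B' t + (1 + C) * δ = r :=
    ⟨(r - C * B' t) / (1 + C), div_pos (sub_pos.2 hr) (by positivity), by field_simp; ring⟩
  have hψslope : ∀ᶠ z in 𝓝[>] t,
      slope (fun τ => ‖ψ τ - ψ a‖) t z < C * (q t * ‖u t‖) + δ :=
    eventually_slope_norm_lt_of_dissipative (A := 0) (q := 0) (w := ψ' t)
      (by simpa using (hψ t ht).sub_const (ψ a)) (by simp) (by linarith [hψ' t ht])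
  have huslope : ∀ᶠ z in 𝓝[>] t, slope (fun τ => ‖u τ‖) t z < B' t - q t * ‖u t‖ + δ :=
    eventually_slope_norm_lt_of_dissipative (hu t ht) (hA t ht) (by linarith [hw t ht])
  filter_upwards [hψslope, huslope] with z hψz huz
  have hadd : slope (fun τ => ‖ψ τ - ψ a‖ + C * ‖u τ‖) t z =
      slope (fun τ => ‖ψ τ - ψ a‖) t z + C * slope (fun τ => ‖u τ‖) t z := by
    simp only [slope_def_field]; ring
  rw [hadd, ← hrδ]
  linarith [mul_le_mul_of_nonneg_left huz.le hC]

theorem norm_le_gronwallBound_of_dissipative {u w : ℝ → E} {A : ℝ → E →L[ℝ] E} {k ε a b : ℝ}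
    (huc : ContinuousOn u (Set.Icc a b))
    (hu : ∀ t ∈ Set.Ico a b, HasDerivWithinAt u (w t - A t (u t)) (Set.Ici t) t)
    (hA : ∀ t ∈ Set.Ico a b, k * ‖u t‖ ^ 2 ≤ inner ℝ (u t) (A t (u t)))
    (hw : ∀ t ∈ Set.Ico a b, ‖w t‖ ≤ ε) {t : ℝ} (ht : t ∈ Set.Icc a b) :
    ‖u t‖ ≤ gronwallBound ‖u a‖ (-k) ε (t - a) :=
  le_gronwallBound_of_liminf_deriv_right_le (f' := fun t => ‖w t‖ - k * ‖u t‖) huc.norm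
    (fun t ht _ hr =>
      (eventually_slope_norm_lt_of_dissipative (hu t ht) (hA t ht) hr).frequently)
    le_rfl (fun t ht => by linarith [hw t ht]) t ht

theorem forall_lt_of_forall_Ico_le {g : ℝ → ℝ} {a b ε : ℝ} (hg : ContinuousOn g (Set.Icc a b))
    (h : ∀ τ ∈ Set.Icc a b, (∀ t ∈ Set.Ico a τ, g t ≤ ε) → g τ < ε) :
    ∀ t ∈ Set.Icc a b, g t < ε := by
  intro t ht
  by_contra! hεt
  have hcompact : IsCompact (Set.Icc a b ∩ g ⁻¹' Set.Ici ε) :=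
    isCompact_Icc.of_isClosed_subset (hg.preimage_isClosed_of_isClosed isClosed_Icc isClosed_Ici)
      Set.inter_subset_left
  obtain ⟨τ, ⟨hτ, hετ⟩, hfirst⟩ := hcompact.exists_isLeast ⟨t, ht, hεt⟩
  refine (h τ hτ fun s hs => ?_).not_ge hετ
  by_contra! hεs
  exact hs.2.not_ge (hfirst ⟨⟨hs.1, hs.2.le.trans hτ.2⟩, hεs.le⟩)

end Dissipation

section OrthogonalKernel

open scoped InnerProduct

variable {V W : Type*} [NormedAddCommGroup V] [InnerProductSpace ℝ V]
  [NormedAddCommGroup W] [InnerProductSpace ℝ W] {J : V →L[ℝ] W}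

theorem norm_sq_eq_add_norm_sub_sq_of_mem_orthogonal_ker {h h' : V} (hh : h ∈ J.kerᗮ)
    (heq : J h' = J h) : ‖h'‖ ^ 2 = ‖h‖ ^ 2 + ‖h' - h‖ ^ 2 := by
  have horth : inner ℝ h (h' - h) = 0 :=
    Submodule.inner_left_of_mem_orthogonal (K := J.ker) (by simp [heq]) hh
  simpa [sq] using norm_add_sq_eq_norm_sq_add_norm_sq_of_inner_eq_zero h (h' - h) horth

variable [CompleteSpace V]

theorem exists_mem_orthogonal_ker_map_eq (hJ : Function.Surjective J) (y : W) :
    ∃ h ∈ J.kerᗮ, J h = y := by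
  obtain ⟨v, rfl⟩ := hJ y
  have hker : J (J.ker.starProjection v) = 0 := J.ker.starProjection_apply_mem v
  exact ⟨_, J.ker.sub_starProjection_mem_orthogonal v, by rw [map_sub, hker, sub_zero]⟩

variable [CompleteSpace W]

theorem exists_norm_le_mul_norm_map_add_norm_starProjection_ker (hJ : Function.Surjective J) :
    ∃ C, ∀ v, ‖v‖ ≤ C * ‖J v‖ + ‖J.ker.starProjection v‖ := by
  obtain ⟨C, -, hpre⟩ := J.exists_preimage_norm_le hJ
  refine ⟨2 * C, fun v => ?_⟩
  obtain ⟨v', hv', hle⟩ := hpre (J v)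
  have hfix : J.ker.starProjection (v - v') = v - v' :=
    Submodule.starProjection_eq_self_iff.2 (by simp [hv'])
  calc ‖v‖ = ‖v' + J.ker.starProjection v - J.ker.starProjection v'‖ := by
        rw [add_sub_assoc, ← map_sub, hfix, add_sub_cancel]
    _ ≤ ‖v'‖ + ‖J.ker.starProjection v‖ + ‖J.ker.starProjection v'‖ :=
        (norm_sub_le _ _).trans (by gcongr; exact norm_add_le _ _)
    _ ≤ 2 * C * ‖J v‖ + ‖J.ker.starProjection v‖ := by
        linarith [J.ker.norm_starProjection_apply_le v']

theorem tendsto_of_tendsto_map_of_tendsto_starProjection_ker (hJ : Function.Surjective J)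
    {ι : Type*} {l : Filter ι} {u : ι → V} {h : V} (hh : h ∈ J.kerᗮ)
    (hmap : Tendsto (fun i => J (u i)) l (𝓝 (J h)))
    (hproj : Tendsto (fun i => J.ker.starProjection (u i)) l (𝓝 0)) : Tendsto u l (𝓝 h) := by
  obtain ⟨C, hC⟩ := exists_norm_le_mul_norm_map_add_norm_starProjection_ker hJ
  rw [tendsto_iff_norm_sub_tendsto_zero] at hmap ⊢
  have hlim := (hmap.const_mul C).add hproj.norm
  simp only [mul_zero, norm_zero, add_zero] at hlim
  refine squeeze_zero (fun _ => norm_nonneg _) (fun i => ?_) hlim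
  simpa [(J.ker.starProjection_apply_eq_zero_iff).2 hh] using hC (u i - h)

theorem starProjection_ker_comp_adjoint : J.ker.starProjection ∘L J† = 0 := by
  ext1 w
  refine (J.ker.starProjection_apply_eq_zero_iff).2 fun v hv => ?_
  exact (J.adjoint_inner_right v w).trans (by rw [show J v = 0 from hv, inner_zero_left])

theorem exists_pos_mul_norm_le_norm_adjoint (hJ : Function.Surjective J) :
    ∃ κ > 0, ∀ w, κ * ‖w‖ ≤ ‖(J†) w‖ := by
  obtain ⟨C, hC, hpre⟩ := J.exists_preimage_norm_le hJ
  refine ⟨C⁻¹, inv_pos.2 hC, fun w => ?_⟩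
  obtain ⟨v, rfl, hv⟩ := hpre w
  rcases (norm_nonneg (J v)).eq_or_lt with h0 | hpos
  · simp [← h0]
  · refine (inv_mul_le_iff₀ hC).2 (le_of_mul_le_mul_right ?_ hpos)
    calc ‖J v‖ * ‖J v‖ = inner ℝ ((J†) (J v)) v := by
          rw [J.adjoint_inner_left, real_inner_self_eq_norm_mul_norm]
      _ ≤ ‖(J†) (J v)‖ * ‖v‖ := real_inner_le_norm _ _
      _ ≤ ‖(J†) (J v)‖ * (C * ‖J v‖) := by gcongr
      _ = C * ‖(J†) (J v)‖ * ‖J v‖ := by ring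

end OrthogonalKernel

section Homogeneous

variable {V W : Type*} [NormedAddCommGroup V] [NormedSpace ℝ V]
  [NormedAddCommGroup W] [NormedSpace ℝ W] {G : V → W} {L : ℝ}

/-- Positive homogeneity of degree `L` of a map between real vector spaces; the vector-valued
counterpart of `IsHomogeneousModel`, so that it also applies to derivatives. -/
def IsPosHomogeneous (G : V → W) (L : ℝ) : Prop :=
  ∀ c : ℝ, 0 < c → ∀ v, G (c • v) = c ^ L • G v

protected theorem IsPosHomogeneous.fderiv (hG : IsPosHomogeneous G L) :
    IsPosHomogeneous (fderiv ℝ G) (L - 1) := by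
  intro c hc v
  have hscale : c • fderiv ℝ G (c • v) = c ^ L • fderiv ℝ G v := by
    rw [← fderiv_comp_smul, funext (hG c hc)]
    exact congrFun (fderiv_const_smul_field (f := G) (c ^ L)) v
  rw [Real.rpow_sub_one hc.ne', div_eq_inv_mul, mul_smul, ← hscale, inv_smul_smul₀ hc.ne']

/-- For `L < 1` the derivative would blow up along the ray towards the origin. -/
theorem IsPosHomogeneous.one_le (hG : IsPosHomogeneous G L) (hcont : Continuous (fderiv ℝ G))
    {v : V} (hv : fderiv ℝ G v ≠ 0) : 1 ≤ L := by
  by_contra! hL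
  have hblowup : Tendsto (fun c : ℝ => c ^ (L - 1) * ‖fderiv ℝ G v‖) (𝓝[>] 0) atTop :=
    (tendsto_rpow_neg_nhdsGT_zero (sub_neg.2 hL)).atTop_mul_const (norm_pos_iff.2 hv)
  have hbdd : Tendsto (fun c : ℝ => ‖fderiv ℝ G (c • v)‖) (𝓝[>] 0)
      (𝓝 ‖fderiv ℝ G ((0 : ℝ) • v)‖) :=
    ((hcont.comp (continuous_id.smul continuous_const)).norm.tendsto 0).mono_left
      nhdsWithin_le_nhds
  refine not_tendsto_atTop_of_tendsto_nhds hbdd (hblowup.congr' ?_)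
  filter_upwards [self_mem_nhdsWithin] with c (hc : 0 < c)
  rw [hG.fderiv c hc, norm_smul, Real.norm_of_nonneg (Real.rpow_nonneg hc.le _)]

/-- A parameter at which an `L`-homogeneous `C¹` map vanishes and has onto derivative: the direction
along which a model is initialized at a large scale. -/
structure IsKernelInitialization (G : V → W) (L : ℝ) (θ₀ : V) : Prop where
  isPosHomogeneous : IsPosHomogeneous G L
  one_le : 1 ≤ L
  contDiff : ContDiff ℝ 1 G
  map_eq_zero : G θ₀ = 0
  surjective_fderiv : Function.Surjective (fderiv ℝ G θ₀)

variable {θ₀ : V}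

theorem IsKernelInitialization.pos (hinit : IsKernelInitialization G L θ₀) : 0 < L :=
  zero_lt_one.trans_le hinit.one_le

theorem IsKernelInitialization.differentiable (hinit : IsKernelInitialization G L θ₀) :
    Differentiable ℝ G :=
  hinit.contDiff.differentiable one_ne_zero

end Homogeneous

section DecayScale

/-- The factor by which weight decay `lam` alone shrinks parameters of initial scale `a` up to
time `t`. -/
noncomputable def decayScale (a lam t : ℝ) : ℝ := a * Real.exp (-(lam * t))

variable {a lam : ℝ}

theorem decayScale_pos (ha : 0 < a) (t : ℝ) : 0 < decayScale a lam t :=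
  mul_pos ha (Real.exp_pos _)

@[simp]
theorem decayScale_zero : decayScale a lam 0 = a := by simp [decayScale]

theorem antitone_decayScale (ha : 0 ≤ a) (hlam : 0 ≤ lam) : Antitone (decayScale a lam) := by
  intro s t hst
  unfold decayScale
  gcongr

theorem hasDerivAt_decayScale_rpow (ha : 0 < a) (s t : ℝ) :
    HasDerivAt (fun τ => decayScale a lam τ ^ s) (-(lam * s * decayScale a lam t ^ s)) t := by
  have hpos := decayScale_pos (lam := lam) ha t
  have hscale : HasDerivAt (decayScale a lam) (-(lam * decayScale a lam t)) t :=
    (((hasDerivAt_id t).const_mul lam).neg.exp.const_mul a).congr_deriv (by simp [decayScale]; ring)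
  refine (hscale.rpow_const (p := s) (Or.inl hpos.ne')).congr_deriv ?_
  rw [Real.rpow_sub_one hpos.ne']
  field_simp

end DecayScale

section RescaledFlow

variable {V W : Type*} [NormedAddCommGroup V] [NormedSpace ℝ V]
  [NormedAddCommGroup W] [NormedSpace ℝ W] {a lam : ℝ}

/-- The flow `θ` divided by `decayScale a lam`, which removes the effect of pure weight decay. -/
noncomputable def rescaledFlow (a lam : ℝ) (θ : ℝ → V) (t : ℝ) : V :=
  (decayScale a lam t)⁻¹ • θ t

/-- The residual `G (θ t) - y` of an `L`-homogeneous map `G`, divided by the factor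
`decayScale a lam t ^ L` by which the rescaling of the flow divides the outputs. -/
noncomputable def rescaledResidual (G : V → W) (y : W) (L a lam : ℝ) (θ : ℝ → V) (t : ℝ) : W :=
  G (rescaledFlow a lam θ t) - decayScale a lam t ^ (-L) • y

/-- The displacement `rescaledFlow - θ₀` in the normalization in which it has a finite limit when
the initial scale of an `L`-homogeneous model tends to infinity. -/
noncomputable def scaledDisplacement (L a lam : ℝ) (θ₀ : V) (θ : ℝ → V) (t : ℝ) : V :=
  decayScale a lam t ^ L • (rescaledFlow a lam θ t - θ₀)

theorem decayScale_smul_rescaledFlow (ha : 0 < a) (θ : ℝ → V) (t : ℝ) :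
    decayScale a lam t • rescaledFlow a lam θ t = θ t :=
  smul_inv_smul₀ (decayScale_pos ha t).ne' _

variable {G : V → W} {L : ℝ}

theorem IsPosHomogeneous.map_eq_smul_map_rescaledFlow (hG : IsPosHomogeneous G L) (ha : 0 < a)
    (lam : ℝ) (θ : ℝ → V) (t : ℝ) :
    G (θ t) = decayScale a lam t ^ L • G (rescaledFlow a lam θ t) := by
  rw [← hG _ (decayScale_pos ha t), decayScale_smul_rescaledFlow ha]

theorem IsPosHomogeneous.map_sub_eq_smul_rescaledResidual (hG : IsPosHomogeneous G L) (ha : 0 < a)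
    (lam : ℝ) (y : W) (θ : ℝ → V) (t : ℝ) :
    G (θ t) - y = decayScale a lam t ^ L • rescaledResidual G y L a lam θ t := by
  rw [rescaledResidual, smul_sub, ← hG.map_eq_smul_map_rescaledFlow ha, smul_smul,
    ← Real.rpow_add (decayScale_pos ha t), add_neg_cancel, Real.rpow_zero, one_smul]

end RescaledFlow

section WeightDecayFlow

open scoped InnerProduct

variable {V W : Type*} [NormedAddCommGroup V] [InnerProductSpace ℝ V] [CompleteSpace V]
  [NormedAddCommGroup W] [InnerProductSpace ℝ W] [CompleteSpace W]

/-- The gradient flow of `μ / 2 * ‖G θ - y‖ ^ 2 + lam / 2 * ‖θ‖ ^ 2` on `[0, ∞)` started at `θ₀`,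
with the gradient written out by means of the adjoint of the derivative of `G`. -/
structure IsWeightDecayFlow (G : V → W) (y : W) (μ lam : ℝ) (θ₀ : V) (θ : ℝ → V) : Prop where
  init : θ 0 = θ₀
  hasDerivWithinAt : ∀ t, 0 ≤ t → HasDerivWithinAt θ
    (-(μ • ((fderiv ℝ G (θ t))†) (G (θ t) - y) + lam • θ t)) (Set.Ici 0) t

/-- The neural tangent kernel `J J†` of `G` at `v`, where `J` is the derivative of `G` at `v`. -/
noncomputable def ntkOperator (G : V → W) (v : V) : W →L[ℝ] W :=
  fderiv ℝ G v ∘L (fderiv ℝ G v)†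

variable {G : V → W} {y : W} {L μ lam a : ℝ} {θ₀ : V} {θ : ℝ → V} {t : ℝ}

theorem mul_norm_sq_le_inner_ntkOperator {v : V} {κ c : ℝ} (hκ : 0 ≤ κ) (hc : 0 ≤ c) {w : W}
    (h : κ * ‖w‖ ≤ ‖((fderiv ℝ G v)†) w‖) :
    c * κ ^ 2 * ‖w‖ ^ 2 ≤ inner ℝ w ((c • ntkOperator G v) w) := by
  have hinner : inner ℝ w (ntkOperator G v w) = ‖((fderiv ℝ G v)†) w‖ ^ 2 := by
    rw [ntkOperator, ContinuousLinearMap.comp_apply, ← ContinuousLinearMap.adjoint_inner_left,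
      real_inner_self_eq_norm_sq]
  rw [smul_apply, inner_smul_right, hinner, mul_assoc, ← mul_pow]
  gcongr

theorem IsPosHomogeneous.adjoint_fderiv_apply (hG : IsPosHomogeneous G L) (ha : 0 < a) (lam : ℝ)
    (θ : ℝ → V) (t : ℝ) (w : W) :
    ((fderiv ℝ G (θ t))†) w =
      decayScale a lam t ^ (L - 1) • ((fderiv ℝ G (rescaledFlow a lam θ t))†) w := by
  rw [hG.fderiv.map_eq_smul_map_rescaledFlow ha lam θ t, map_smulₛₗ]
  rfl

namespace IsWeightDecayFlow

theorem hasDerivWithinAt_rescaledFlow (hflow : IsWeightDecayFlow G y μ lam θ₀ θ)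
    (hG : IsPosHomogeneous G L) (ha : 0 < a) (ht : 0 ≤ t) :
    HasDerivWithinAt (rescaledFlow a lam θ)
      (-(μ * decayScale a lam t ^ (2 * L - 2)) •
        ((fderiv ℝ G (rescaledFlow a lam θ t))†) (rescaledResidual G y L a lam θ t))
      (Set.Ici 0) t := by
  have hb := decayScale_pos (lam := lam) ha t
  have hinv := (hasDerivAt_decayScale_rpow (lam := lam) ha (-1) t).hasDerivWithinAt (s := Set.Ici 0)
  simp only [Real.rpow_neg_one] at hinv
  refine (hinv.smul (hflow.hasDerivWithinAt t ht)).congr_deriv ?_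
  have hpow : decayScale a lam t ^ (2 * L - 2) =
      (decayScale a lam t)⁻¹ * (decayScale a lam t ^ (L - 1) * decayScale a lam t ^ L) := by
    rw [← Real.rpow_neg_one, ← Real.rpow_add hb, ← Real.rpow_add hb]
    ring_nf
  rw [hG.map_sub_eq_smul_rescaledResidual ha lam, hG.adjoint_fderiv_apply ha lam, map_smul, hpow]
  module

theorem hasDerivWithinAt_rescaledResidual (hflow : IsWeightDecayFlow G y μ lam θ₀ θ)
    (hG : IsPosHomogeneous G L) (hdiff : Differentiable ℝ G) (ha : 0 < a) (ht : 0 ≤ t) :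
    HasDerivWithinAt (rescaledResidual G y L a lam θ)
      ((lam * L * decayScale a lam t ^ (-L)) • -y -
        ((μ * decayScale a lam t ^ (2 * L - 2)) • ntkOperator G (rescaledFlow a lam θ t))
          (rescaledResidual G y L a lam θ t)) (Set.Ici 0) t := by
  have hmap := (hdiff (rescaledFlow a lam θ t)).hasFDerivAt.comp_hasDerivWithinAt t
    (hflow.hasDerivWithinAt_rescaledFlow hG ha ht)
  have htarget := (hasDerivAt_decayScale_rpow (lam := lam) ha (-L) t).smul_const y
    |>.hasDerivWithinAt (s := Set.Ici 0)
  refine (hmap.sub htarget).congr_deriv ?_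
  simp only [map_smul, ntkOperator, smul_apply, ContinuousLinearMap.comp_apply]
  module

theorem hasDerivWithinAt_map_sub (hflow : IsWeightDecayFlow G y μ lam θ₀ θ)
    (hG : IsPosHomogeneous G L) (hdiff : Differentiable ℝ G) (ha : 0 < a) (ht : 0 ≤ t) :
    HasDerivWithinAt (fun τ => G (θ τ) - y)
      ((lam * L) • -y -
        ((μ * decayScale a lam t ^ (2 * L - 2)) • ntkOperator G (rescaledFlow a lam θ t) +
          (lam * L) • ContinuousLinearMap.id ℝ W) (G (θ t) - y)) (Set.Ici 0) t := by
  have hprod := (hasDerivAt_decayScale_rpow (lam := lam) ha L t).hasDerivWithinAt (s := Set.Ici 0)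
    |>.smul (hflow.hasDerivWithinAt_rescaledResidual hG hdiff ha ht)
  have hcancel : decayScale a lam t ^ L * decayScale a lam t ^ (-L) = 1 := by
    rw [← Real.rpow_add (decayScale_pos ha t), add_neg_cancel, Real.rpow_zero]
  simp only [hG.map_sub_eq_smul_rescaledResidual ha lam]
  refine hprod.congr_deriv ?_
  simp only [add_apply, smul_apply, map_smul, ContinuousLinearMap.id_apply]
  linear_combination (norm := module) hcancel • (-(lam * L) • y)

theorem continuousOn_rescaledFlow (hflow : IsWeightDecayFlow G y μ lam θ₀ θ)
    (hG : IsPosHomogeneous G L) (ha : 0 < a) : ContinuousOn (rescaledFlow a lam θ) (Set.Ici 0) :=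
  fun _ ht => (hflow.hasDerivWithinAt_rescaledFlow hG ha ht).continuousWithinAt

theorem rescaledFlow_zero (hflow : IsWeightDecayFlow G y μ lam (a • θ₀) θ) (ha : 0 < a) :
    rescaledFlow a lam θ 0 = θ₀ := by
  rw [rescaledFlow, decayScale_zero, hflow.init, inv_smul_smul₀ ha.ne']

/-- The dissipated residual pays for the movement: `‖P φ - P θ₀‖ + C ‖s‖` grows at most as fast as
`C * decayScale ^ (-L) * ‖y‖`, where `φ` is the rescaled flow and `s` its residual. -/
theorem norm_map_rescaledFlow_sub_le (hflow : IsWeightDecayFlow G y μ lam (a • θ₀) θ)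
    (hG : IsPosHomogeneous G L) (hdiff : Differentiable ℝ G) (h0 : G θ₀ = 0) (ha : 0 < a)
    (hlam : 0 ≤ lam) (hμ : 0 ≤ μ) (hL : 0 ≤ L) {P : V →L[ℝ] V} {κ η T : ℝ} (hκ : 0 < κ)
    (hη : 0 ≤ η)
    (hadj : ∀ t ∈ Set.Ico 0 T, ∀ w, κ * ‖w‖ ≤ ‖((fderiv ℝ G (rescaledFlow a lam θ t))†) w‖)
    (hP : ∀ t ∈ Set.Ico 0 T, ‖P ∘L (fderiv ℝ G (rescaledFlow a lam θ t))†‖ ≤ η)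
    (ht : t ∈ Set.Icc 0 T) :
    ‖P (rescaledFlow a lam θ t - θ₀)‖ ≤ η / κ ^ 2 * (decayScale a lam t ^ (-L) * ‖y‖) := by
  have hb (t s : ℝ) : 0 ≤ decayScale a lam t ^ s := Real.rpow_nonneg (decayScale_pos ha t).le s
  have hφ (t : ℝ) (ht : 0 ≤ t) := P.hasFDerivAt.comp_hasDerivWithinAt t
    (hflow.hasDerivWithinAt_rescaledFlow hG ha ht)
  have hs (t : ℝ) (ht : 0 ≤ t) := hflow.hasDerivWithinAt_rescaledResidual hG hdiff ha ht
  have hB (t : ℝ) := (hasDerivAt_decayScale_rpow (lam := lam) ha (-L) t).mul_const ‖y‖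
  have hbound := norm_sub_add_mul_norm_le_of_dissipative (C := η / κ ^ 2) (by positivity)
    (fun t ht => (hφ t ht.1).continuousWithinAt.mono Set.Icc_subset_Ici_self)
    (fun t ht => (hφ t ht.1).mono (Set.Ici_subset_Ici.2 ht.1))
    (fun t ht => (hs t ht.1).continuousWithinAt.mono Set.Icc_subset_Ici_self)
    (fun t ht => (hs t ht.1).mono (Set.Ici_subset_Ici.2 ht.1))
    (fun t _ => (hB t).continuousAt.continuousWithinAt) (fun t _ => (hB t).hasDerivWithinAt)
    (fun t ht => mul_norm_sq_le_inner_ntkOperator hκ.le (mul_nonneg hμ (hb t _)) (hadj t ht _))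
    (fun t ht => ?_) (fun t _ => ?_) ?_ ht
  · simp only [Function.comp_apply, ← map_sub, hflow.rescaledFlow_zero ha] at hbound
    exact (le_add_of_nonneg_right (by positivity)).trans hbound
  · have hPs := (P ∘L (fderiv ℝ G (rescaledFlow a lam θ t))†).le_of_opNorm_le (hP t ht)
      (rescaledResidual G y L a lam θ t)
    rw [map_smul, norm_smul, norm_neg, Real.norm_of_nonneg (mul_nonneg hμ (hb t _))]
    refine (mul_le_mul_of_nonneg_left hPs (mul_nonneg hμ (hb t _))).trans_eq ?_
    field_simp
  · rw [norm_smul, norm_neg, Real.norm_of_nonneg (mul_nonneg (mul_nonneg hlam hL) (hb t _))]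
    exact (by ring : _ = _).le
  · rw [rescaledResidual, hflow.rescaledFlow_zero ha, h0, zero_sub, norm_neg, norm_smul,
      Real.norm_of_nonneg (hb 0 _)]

theorem norm_rescaledFlow_sub_lt (hflow : IsWeightDecayFlow G y μ lam (a • θ₀) θ)
    (hG : IsPosHomogeneous G L) (hdiff : Differentiable ℝ G) (h0 : G θ₀ = 0) (ha : 0 < a)
    (hlam : 0 ≤ lam) (hμ : 0 ≤ μ) (hL : 0 ≤ L) {κ M ε T : ℝ} (hκ : 0 < κ) (hM : 0 ≤ M)
    (hadj : ∀ v ∈ Metric.closedBall θ₀ ε, ∀ w, κ * ‖w‖ ≤ ‖((fderiv ℝ G v)†) w‖)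
    (hnorm : ∀ v ∈ Metric.closedBall θ₀ ε, ‖(fderiv ℝ G v)†‖ ≤ M)
    (hT : M / κ ^ 2 * (decayScale a lam T ^ (-L) * ‖y‖) < ε) (ht : t ∈ Set.Icc 0 T) :
    ‖rescaledFlow a lam θ t - θ₀‖ < ε := by
  refine forall_lt_of_forall_Ico_le (g := fun t => ‖rescaledFlow a lam θ t - θ₀‖)
    (((hflow.continuousOn_rescaledFlow hG ha).mono Set.Icc_subset_Ici_self).sub
      continuousOn_const).norm (fun τ hτ hball => ?_) t ht
  have hmem (t : ℝ) (ht : t ∈ Set.Ico 0 τ) : rescaledFlow a lam θ t ∈ Metric.closedBall θ₀ ε :=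
    mem_closedBall_iff_norm.2 (hball t ht)
  calc ‖rescaledFlow a lam θ τ - θ₀‖
      ≤ M / κ ^ 2 * (decayScale a lam τ ^ (-L) * ‖y‖) :=
        hflow.norm_map_rescaledFlow_sub_le hG hdiff h0 ha hlam hμ hL
          (P := ContinuousLinearMap.id ℝ V) hκ hM (fun t ht => hadj _ (hmem t ht))
          (fun t ht => hnorm _ (hmem t ht)) ⟨hτ.1, le_rfl⟩
    _ ≤ M / κ ^ 2 * (decayScale a lam T ^ (-L) * ‖y‖) := by
        gcongr ?_ * (?_ * _)
        exact Real.rpow_le_rpow_of_nonpos (decayScale_pos ha T)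
          (antitone_decayScale ha.le hlam hτ.2) (neg_nonpos.2 hL)
    _ < ε := hT

theorem norm_map_sub_le (hflow : IsWeightDecayFlow G y μ lam (a • θ₀) θ)
    (hG : IsPosHomogeneous G L) (hdiff : Differentiable ℝ G) (h0 : G θ₀ = 0) (ha : 0 < a)
    (hlam : 0 ≤ lam) (hμ : 0 < μ) (hL : 1 ≤ L) {κ T : ℝ} (hκ : 0 < κ)
    (hadj : ∀ t ∈ Set.Ico 0 T, ∀ w, κ * ‖w‖ ≤ ‖((fderiv ℝ G (rescaledFlow a lam θ t))†) w‖)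
    (hT₀ : 0 ≤ T) (hT : 1 ≤ decayScale a lam T) :
    ‖G (θ T) - y‖ ≤
      ‖y‖ * Real.exp (-(μ * κ ^ 2) * T) + lam * L * ‖y‖ / (μ * κ ^ 2) := by
  have hr (t : ℝ) (ht : 0 ≤ t) := hflow.hasDerivWithinAt_map_sub hG hdiff ha ht
  have hk : 0 < μ * κ ^ 2 := by positivity
  have hlamL : 0 ≤ lam * L := mul_nonneg hlam (zero_le_one.trans hL)
  have hinit : G (θ 0) = 0 := by rw [hflow.init, hG a ha, h0, smul_zero]
  have hgron := norm_le_gronwallBound_of_dissipative (k := μ * κ ^ 2) (ε := lam * L * ‖y‖)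
    (fun t ht => (hr t ht.1).continuousWithinAt.mono Set.Icc_subset_Ici_self)
    (fun t ht => (hr t ht.1).mono (Set.Ici_subset_Ici.2 ht.1)) (fun t ht => ?_)
    (fun t _ => by rw [norm_smul, norm_neg, Real.norm_of_nonneg hlamL])
    (Set.right_mem_Icc.2 hT₀)
  · rw [hinit, zero_sub, norm_neg, sub_zero, gronwallBound_of_K_ne_0 (neg_ne_zero.2 hk.ne'),
      div_neg] at hgron
    have hexp : 0 ≤ lam * L * ‖y‖ / (μ * κ ^ 2) * Real.exp (-(μ * κ ^ 2) * T) := by positivity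
    linarith
  · have hpow : 1 ≤ decayScale a lam t ^ (2 * L - 2) :=
      Real.one_le_rpow (hT.trans (antitone_decayScale ha.le hlam ht.2.le)) (by linarith)
    have hker := mul_norm_sq_le_inner_ntkOperator hκ.le
      (hμ.le.trans (le_mul_of_one_le_right hμ.le hpow)) (hadj t ht (G (θ t) - y))
    rw [add_apply, inner_add_right]
    refine le_trans ?_ (hker.trans (le_add_of_nonneg_right ?_))
    · gcongr
      exact le_mul_of_one_le_right hμ.le hpow
    · rw [smul_apply, ContinuousLinearMap.id_apply, inner_smul_right, real_inner_self_eq_norm_sq]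
      positivity

end IsWeightDecayFlow

end WeightDecayFlow

section KernelRegime

open scoped InnerProduct

variable {V W : Type*} [NormedAddCommGroup V] [InnerProductSpace ℝ V] [CompleteSpace V]
  [NormedAddCommGroup W] [InnerProductSpace ℝ W] [CompleteSpace W]
  {G : V → W} {L : ℝ} {θ₀ : V} {y : W} {μ : ℝ}

theorem continuous_adjoint_fderiv (hG : ContDiff ℝ 1 G) : Continuous fun v => (fderiv ℝ G v)† :=
  ContinuousLinearMap.adjoint.continuous.comp (hG.continuous_fderiv one_ne_zero)

theorem exists_pos_eventually_mul_norm_le_norm_adjoint_fderiv (hG : ContDiff ℝ 1 G)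
    (hJ : Function.Surjective (fderiv ℝ G θ₀)) :
    ∃ κ > 0, ∀ᶠ v in 𝓝 θ₀, ∀ w, κ * ‖w‖ ≤ ‖((fderiv ℝ G v)†) w‖ := by
  obtain ⟨κ, hκ, hκ₀⟩ := exists_pos_mul_norm_le_norm_adjoint hJ
  refine ⟨κ / 2, half_pos hκ, ?_⟩
  filter_upwards [(continuous_adjoint_fderiv hG).tendsto θ₀ |>.eventually
    (Metric.closedBall_mem_nhds _ (half_pos hκ))] with v hv w
  have hclose := ((fderiv ℝ G v)† - (fderiv ℝ G θ₀)†).le_of_opNorm_le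
    (mem_closedBall_iff_norm.1 hv) w
  rw [sub_apply] at hclose
  linarith [hκ₀ w, norm_le_norm_add_norm_sub (((fderiv ℝ G v)†) w) (((fderiv ℝ G θ₀)†) w)]

/-- A family of weight-decay flows started at `a i • θ₀` and observed at times `T i` which, along
`l`, run for longer and longer with weaker and weaker weight decay, but stop before weight decay
has shrunk the initial scale `a i` back to a bounded size. -/
structure IsKernelRegime {ι : Type*} (l : Filter ι) (G : V → W) (y : W) (μ : ℝ) (θ₀ : V)
    (a lam T : ι → ℝ) (θ : ι → ℝ → V) : Prop where
  mu_pos : 0 < μ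
  eventually_isWeightDecayFlow :
    ∀ᶠ i in l, IsWeightDecayFlow G y μ (lam i) (a i • θ₀) (θ i)
  eventually_lam_nonneg : ∀ᶠ i in l, 0 ≤ lam i
  tendsto_lam : Tendsto lam l (𝓝 0)
  tendsto_time : Tendsto T l atTop
  tendsto_decayScale : Tendsto (fun i => decayScale (a i) (lam i) (T i)) l atTop

namespace IsKernelRegime

variable {ι : Type*} {l : Filter ι} {a lam T : ι → ℝ} {θ : ι → ℝ → V}

theorem eventually_pos (hreg : IsKernelRegime l G y μ θ₀ a lam T θ) : ∀ᶠ i in l, 0 < a i :=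
  (hreg.tendsto_decayScale.eventually_gt_atTop 0).mono fun _ hi =>
    pos_of_mul_pos_left hi (Real.exp_pos _).le

theorem eventually_forall_rescaledFlow (hreg : IsKernelRegime l G y μ θ₀ a lam T θ)
    (hinit : IsKernelInitialization G L θ₀) {p : V → Prop}
    (hp : ∀ᶠ v in 𝓝 θ₀, p v) :
    ∀ᶠ i in l, ∀ t ∈ Set.Icc 0 (T i), p (rescaledFlow (a i) (lam i) (θ i) t) := by
  obtain ⟨κ, hκ, hadj⟩ := exists_pos_eventually_mul_norm_le_norm_adjoint_fderiv
    hinit.contDiff hinit.surjective_fderiv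
  have hnorm : ∀ᶠ v in 𝓝 θ₀, ‖(fderiv ℝ G v)†‖ < ‖(fderiv ℝ G θ₀)†‖ + 1 :=
    (continuous_adjoint_fderiv hinit.contDiff).norm.tendsto θ₀ |>.eventually_lt_const (lt_add_one _)
  obtain ⟨ε, hε, hball⟩ :=
    Metric.nhds_basis_closedBall.eventually_iff.1 (hadj.and (hnorm.and hp))
  have hsmall : Tendsto (fun i => (‖(fderiv ℝ G θ₀)†‖ + 1) / κ ^ 2 *
      (decayScale (a i) (lam i) (T i) ^ (-L) * ‖y‖)) l (𝓝 0) := by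
    simpa using (((tendsto_rpow_neg_atTop hinit.pos).comp hreg.tendsto_decayScale).mul_const
      ‖y‖).const_mul ((‖(fderiv ℝ G θ₀)†‖ + 1) / κ ^ 2)
  filter_upwards [hreg.eventually_isWeightDecayFlow, hreg.eventually_lam_nonneg,
    hreg.eventually_pos, hsmall.eventually_lt_const hε] with i hflow hlam ha hT t ht
  refine (hball (mem_closedBall_iff_norm.2 (le_of_lt ?_))).2.2
  exact hflow.norm_rescaledFlow_sub_lt hinit.isPosHomogeneous hinit.differentiable
    hinit.map_eq_zero ha hlam hreg.mu_pos.le hinit.pos.le hκ (by positivity)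
    (fun v hv => (hball hv).1) (fun v hv => (hball hv).2.1.le) hT ht

theorem tendsto_rescaledFlow (hreg : IsKernelRegime l G y μ θ₀ a lam T θ)
    (hinit : IsKernelInitialization G L θ₀) :
    Tendsto (fun i => rescaledFlow (a i) (lam i) (θ i) (T i)) l (𝓝 θ₀) := by
  refine tendsto_iff_eventually.2 fun p hp => ?_
  filter_upwards [hreg.eventually_forall_rescaledFlow hinit hp,
    hreg.tendsto_time.eventually_ge_atTop 0] with i hi hT
  exact hi _ (Set.right_mem_Icc.2 hT)

theorem tendsto_map (hreg : IsKernelRegime l G y μ θ₀ a lam T θ)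
    (hinit : IsKernelInitialization G L θ₀) :
    Tendsto (fun i => G (θ i (T i))) l (𝓝 y) := by
  obtain ⟨κ, hκ, hadj⟩ := exists_pos_eventually_mul_norm_le_norm_adjoint_fderiv
    hinit.contDiff hinit.surjective_fderiv
  have hexp : Tendsto (fun i => ‖y‖ * Real.exp (-(μ * κ ^ 2) * T i)) l (𝓝 0) := by
    have hneg := hreg.tendsto_time.const_mul_atTop_of_neg
      (neg_neg_of_pos (mul_pos hreg.mu_pos (pow_pos hκ 2)))
    simpa using (Real.tendsto_exp_atBot.comp hneg).const_mul ‖y‖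
  have hdrift : Tendsto (fun i => lam i * L * ‖y‖ / (μ * κ ^ 2)) l (𝓝 0) := by
    simpa using ((hreg.tendsto_lam.mul_const L).mul_const ‖y‖).div_const (μ * κ ^ 2)
  rw [tendsto_iff_norm_sub_tendsto_zero]
  refine squeeze_zero' (.of_forall fun _ => norm_nonneg _) ?_
    (by simpa only [add_zero] using hexp.add hdrift)
  filter_upwards [hreg.eventually_isWeightDecayFlow, hreg.eventually_lam_nonneg,
    hreg.eventually_pos, hreg.tendsto_time.eventually_ge_atTop 0,
    hreg.tendsto_decayScale.eventually_ge_atTop 1,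
    hreg.eventually_forall_rescaledFlow hinit hadj] with i hflow hlam ha hT₀ hT hball
  exact hflow.norm_map_sub_le hinit.isPosHomogeneous hinit.differentiable
    hinit.map_eq_zero ha hlam hreg.mu_pos hinit.one_le hκ
    (fun t ht => hball t (Set.Ico_subset_Icc_self ht)) hT₀ hT

theorem exists_eventually_norm_map_scaledDisplacement_le
    (hreg : IsKernelRegime l G y μ θ₀ a lam T θ) (hinit : IsKernelInitialization G L θ₀) :
    ∃ C, ∀ (P : V →L[ℝ] V) (η : ℝ), ‖P ∘L (fderiv ℝ G θ₀)†‖ < η →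
      ∀ᶠ i in l, ‖P (scaledDisplacement L (a i) (lam i) θ₀ (θ i) (T i))‖ ≤ η * C := by
  obtain ⟨κ, hκ, hadj⟩ := exists_pos_eventually_mul_norm_le_norm_adjoint_fderiv
    hinit.contDiff hinit.surjective_fderiv
  refine ⟨‖y‖ / κ ^ 2, fun P η hη => ?_⟩
  have hη₀ : 0 ≤ η := (norm_nonneg _).trans hη.le
  have hP : ∀ᶠ v in 𝓝 θ₀, ‖P ∘L (fderiv ℝ G v)†‖ < η :=
    (continuous_const.clm_comp (continuous_adjoint_fderiv hinit.contDiff)).norm.tendsto θ₀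
      |>.eventually_lt_const hη
  filter_upwards [hreg.eventually_isWeightDecayFlow, hreg.eventually_lam_nonneg,
    hreg.eventually_pos, hreg.tendsto_time.eventually_ge_atTop 0,
    hreg.eventually_forall_rescaledFlow hinit (hadj.and hP)] with i hflow hlam ha hT hball
  have hb := decayScale_pos (lam := lam i) ha (T i)
  have hmove := hflow.norm_map_rescaledFlow_sub_le hinit.isPosHomogeneous hinit.differentiable
    hinit.map_eq_zero ha hlam hreg.mu_pos.le hinit.pos.le hκ hη₀
    (fun t ht => (hball t (Set.Ico_subset_Icc_self ht)).1)
    (fun t ht => (hball t (Set.Ico_subset_Icc_self ht)).2.le) (Set.right_mem_Icc.2 hT)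
  rw [scaledDisplacement, map_smul, norm_smul, Real.norm_of_nonneg (Real.rpow_nonneg hb.le _)]
  refine (mul_le_mul_of_nonneg_left hmove (Real.rpow_nonneg hb.le _)).trans_eq ?_
  rw [Real.rpow_neg hb.le]
  field_simp

theorem tendsto_map_sub_fderiv_scaledDisplacement (hreg : IsKernelRegime l G y μ θ₀ a lam T θ)
    (hinit : IsKernelInitialization G L θ₀)
    {Z : Type*} [NormedAddCommGroup Z] [NormedSpace ℝ Z] {F : V → Z} (hF : IsPosHomogeneous F L)
    (hdiff : DifferentiableAt ℝ F θ₀) (hF₀ : F θ₀ = 0) :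
    Tendsto (fun i => F (θ i (T i)) -
      fderiv ℝ F θ₀ (scaledDisplacement L (a i) (lam i) θ₀ (θ i) (T i))) l (𝓝 0) := by
  obtain ⟨C, hC⟩ := hreg.exists_eventually_norm_map_scaledDisplacement_le hinit
  have hbdd : (fun i => scaledDisplacement L (a i) (lam i) θ₀ (θ i) (T i)) =O[l]
      fun _ => (1 : ℝ) :=
    .of_bound ((‖(fderiv ℝ G θ₀)†‖ + 1) * C) <| by
      simpa using hC (ContinuousLinearMap.id ℝ V) _ (lt_add_one _)
  have hremainder := hdiff.hasFDerivAt.isLittleO.comp_tendsto (hreg.tendsto_rescaledFlow hinit)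
  have hscaled := (isBigO_refl (fun i => decayScale (a i) (lam i) (T i) ^ L) l).smul_isLittleO
    hremainder
  refine ((isLittleO_one_iff ℝ).1 (hscaled.trans_isBigO hbdd)).congr' ?_
  filter_upwards [hreg.eventually_pos] with i ha
  simp only [Function.comp_apply, hF₀, sub_zero, smul_sub, scaledDisplacement, map_smul, map_sub,
    ← hF.map_eq_smul_map_rescaledFlow ha]

theorem tendsto_scaledDisplacement (hreg : IsKernelRegime l G y μ θ₀ a lam T θ)
    (hinit : IsKernelInitialization G L θ₀) {h : V}
    (hh : h ∈ (fderiv ℝ G θ₀).kerᗮ) (hhy : fderiv ℝ G θ₀ h = y) :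
    Tendsto (fun i => scaledDisplacement L (a i) (lam i) θ₀ (θ i) (T i)) l (𝓝 h) := by
  obtain ⟨C, hC⟩ := hreg.exists_eventually_norm_map_scaledDisplacement_le hinit
  refine tendsto_of_tendsto_map_of_tendsto_starProjection_ker hinit.surjective_fderiv hh ?_ ?_
  · have hinterp := (hreg.tendsto_map hinit).sub
      (hreg.tendsto_map_sub_fderiv_scaledDisplacement hinit hinit.isPosHomogeneous
        (hinit.differentiable θ₀) hinit.map_eq_zero)
    simpa only [sub_sub_cancel, sub_zero, hhy] using hinterp
  · refine Metric.tendsto_nhds.2 fun ε hε => ?_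
    obtain ⟨η, hη, hηC⟩ := exists_pos_mul_lt hε C
    filter_upwards [hC (fderiv ℝ G θ₀).ker.starProjection η
      (by rwa [starProjection_ker_comp_adjoint, norm_zero])] with i hi
    rw [dist_zero_right]
    exact hi.trans_lt (by rwa [mul_comm])

theorem tendsto_map_of_isPosHomogeneous (hreg : IsKernelRegime l G y μ θ₀ a lam T θ)
    (hinit : IsKernelInitialization G L θ₀) {h : V}
    (hh : h ∈ (fderiv ℝ G θ₀).kerᗮ) (hhy : fderiv ℝ G θ₀ h = y)
    {Z : Type*} [NormedAddCommGroup Z] [NormedSpace ℝ Z] {F : V → Z} (hF : IsPosHomogeneous F L)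
    (hdiff : DifferentiableAt ℝ F θ₀) (hF₀ : F θ₀ = 0) :
    Tendsto (fun i => F (θ i (T i))) l (𝓝 (fderiv ℝ F θ₀ h)) := by
  have hlinear := ((fderiv ℝ F θ₀).continuous.tendsto h).comp
    (hreg.tendsto_scaledDisplacement hinit hh hhy)
  simpa using (hreg.tendsto_map_sub_fderiv_scaledDisplacement hinit hF hdiff hF₀).add hlinear

end IsKernelRegime

end KernelRegime

section MinNormInterpolant

variable {D n : ℕ} {g : Fin n → EuclideanSpace ℝ (Fin D)}
  {J : EuclideanSpace ℝ (Fin D) →L[ℝ] EuclideanSpace ℝ (Fin n)}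

theorem eq_toLp_iff_forall_inner_eq (hJ : ∀ v i, J v i = inner ℝ (g i) v) {y : Fin n → ℝ}
    {v : EuclideanSpace ℝ (Fin D)} : J v = WithLp.toLp 2 y ↔ ∀ i, inner ℝ (g i) v = y i := by
  simp only [PiLp.ext_iff, hJ]

theorem isMinNormInterpolant_iff_eq (hJ : ∀ v i, J v i = inner ℝ (g i) v) {y : Fin n → ℝ}
    {h₀ h : EuclideanSpace ℝ (Fin D)} (hh₀ : h₀ ∈ J.kerᗮ) (hy : J h₀ = WithLp.toLp 2 y) :
    IsMinNormInterpolant g y h ↔ h = h₀ := by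
  simp only [IsMinNormInterpolant, ← eq_toLp_iff_forall_inner_eq hJ, ← hy]
  refine ⟨fun ⟨hint, hmin⟩ => ?_, ?_⟩
  · have hpyth := norm_sq_eq_add_norm_sub_sq_of_mem_orthogonal_ker hh₀ hint
    have hle := hmin h₀ rfl
    exact sub_eq_zero.1 (norm_eq_zero.1 (pow_eq_zero_iff two_ne_zero |>.1
      (le_antisymm (by linarith) (sq_nonneg _))))
  · rintro rfl
    refine ⟨rfl, fun h' hint => ?_⟩
    rw [norm_sq_eq_add_norm_sub_sq_of_mem_orthogonal_ker hh₀ hint]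
    linarith [sq_nonneg ‖h' - h‖]

theorem surjective_of_linearIndependent (hJ : ∀ v i, J v i = inner ℝ (g i) v)
    (hg : LinearIndependent ℝ g) : Function.Surjective J := by
  rw [← ContinuousLinearMap.coe_coe, ← LinearMap.range_eq_top, ← Submodule.orthogonal_eq_bot_iff,
    Submodule.eq_bot_iff]
  intro w hw
  have hcomb : ∑ i, w i • g i = 0 := by
    refine ext_inner_right ℝ fun v => ?_
    have hperp : inner ℝ (J v) w = 0 := hw _ ⟨v, rfl⟩
    simpa [sum_inner, inner_smul_left, PiLp.inner_apply, hJ] using hperp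
  ext i
  exact Fintype.linearIndependent_iff.1 hg w hcomb i

end MinNormInterpolant

section Model

open scoped InnerProduct

variable {D n : ℕ} {X : Type*} {f : EuclideanSpace ℝ (Fin D) → X → ℝ} {x : Fin n → X}
  {y : Fin n → ℝ} {L lam : ℝ} {θ θ₀ : EuclideanSpace ℝ (Fin D)}

/-- The vector of outputs of the model `f` on the inputs `x`, as a function of the parameters. -/
noncomputable def modelOutputs (f : EuclideanSpace ℝ (Fin D) → X → ℝ) (x : Fin n → X)
    (θ : EuclideanSpace ℝ (Fin D)) : EuclideanSpace ℝ (Fin n) :=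
  WithLp.toLp 2 fun i => f θ (x i)

theorem contDiff_modelOutputs {k : WithTop ℕ∞} (hf : ∀ i, ContDiff ℝ k fun θ => f θ (x i)) :
    ContDiff ℝ k (modelOutputs f x) :=
  contDiff_euclidean.2 hf

theorem fderiv_apply_eq_inner_ntkFeature {x : X} (hf : DifferentiableAt ℝ (fun θ => f θ x) θ)
    (v : EuclideanSpace ℝ (Fin D)) :
    fderiv ℝ (fun θ => f θ x) θ v = inner ℝ (ntkFeature f θ x) v := by
  rw [hf.hasGradientAt.hasFDerivAt.fderiv, InnerProductSpace.toDual_apply_apply, ntkFeature]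

theorem fderiv_modelOutputs_apply (hf : ∀ i, Differentiable ℝ fun θ => f θ (x i))
    (v : EuclideanSpace ℝ (Fin D)) (i : Fin n) :
    fderiv ℝ (modelOutputs f x) θ v i = inner ℝ (ntkFeature f θ (x i)) v := by
  have houtputs : DifferentiableAt ℝ (modelOutputs f x) θ :=
    differentiableAt_euclidean.2 fun i => hf i θ
  have hproj := (EuclideanSpace.proj (𝕜 := ℝ) i).hasFDerivAt.comp θ houtputs.hasFDerivAt
  rw [← fderiv_apply_eq_inner_ntkFeature (hf i θ)]
  exact congrArg (· v) hproj.fderiv.symm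

theorem isKernelInitialization_modelOutputs (hn : 0 < n) (hhom : IsHomogeneousModel f L)
    (hf : ∀ i, ContDiff ℝ 1 fun θ => f θ (x i)) (hzero : ∀ i, f θ₀ (x i) = 0)
    (hindep : LinearIndependent ℝ fun i => ntkFeature f θ₀ (x i)) :
    IsKernelInitialization (modelOutputs f x) L θ₀ := by
  have hC1 := contDiff_modelOutputs hf
  have hhomG : IsPosHomogeneous (modelOutputs f x) L := fun c hc θ => by
    ext i
    exact hhom (x i) c hc θ
  have hsurj : Function.Surjective (fderiv ℝ (modelOutputs f x) θ₀) :=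
    surjective_of_linearIndependent
      (fderiv_modelOutputs_apply fun i => (hf i).differentiable one_ne_zero) hindep
  have hne : fderiv ℝ (modelOutputs f x) θ₀ ≠ 0 := by
    obtain ⟨v, hv⟩ := hsurj (EuclideanSpace.single ⟨0, hn⟩ 1)
    intro hJ
    simpa [hJ] using congrArg (fun w => w ⟨0, hn⟩) hv
  exact ⟨hhomG, hhomG.one_le (hC1.continuous_fderiv one_ne_zero) hne, hC1,
    by ext i; exact hzero i, hsurj⟩

theorem regLoss_eq_norm_sq (f : EuclideanSpace ℝ (Fin D) → X → ℝ) (x : Fin n → X)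
    (y : Fin n → ℝ) (lam : ℝ) (θ : EuclideanSpace ℝ (Fin D)) :
    regLoss f x y lam θ =
      1 / n * ‖modelOutputs f x θ - WithLp.toLp 2 y‖ ^ 2 + lam / 2 * ‖θ‖ ^ 2 := by
  simp [regLoss, trainLoss, squaredLoss, modelOutputs, EuclideanSpace.norm_sq_eq]

theorem hasGradientAt_regLoss (hf : ∀ i, Differentiable ℝ fun θ => f θ (x i)) :
    HasGradientAt (regLoss f x y lam)
      ((2 / n : ℝ) • ((fderiv ℝ (modelOutputs f x) θ)†) (modelOutputs f x θ - WithLp.toLp 2 y) +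
        lam • θ) θ := by
  have houtputs : DifferentiableAt ℝ (modelOutputs f x) θ :=
    differentiableAt_euclidean.2 fun i => hf i θ
  rw [funext (regLoss_eq_norm_sq f x y lam), hasGradientAt_iff_hasFDerivAt]
  refine (((houtputs.hasFDerivAt.sub_const (WithLp.toLp 2 y)).norm_sq.const_mul (1 / n : ℝ)).add
    ((hasFDerivAt_id θ).norm_sq.const_mul (lam / 2))).congr_fderiv ?_
  ext v
  simp only [one_div, map_sub, ContinuousLinearMap.sub_comp, id_eq, ContinuousLinearMap.comp_id,
    add_apply, smul_apply, sub_apply, ContinuousLinearMap.comp_apply, coe_innerSL_apply,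
    nsmul_eq_mul, Nat.cast_ofNat, smul_eq_mul, map_add, map_smul,
    InnerProductSpace.toDual_apply_apply, ContinuousLinearMap.adjoint_inner_left]
  ring

theorem IsGradientFlow.isWeightDecayFlow {γ : ℝ → EuclideanSpace ℝ (Fin D)}
    (hγ : IsGradientFlow (regLoss f x y lam) θ₀ γ) (hf : ∀ i, Differentiable ℝ fun θ => f θ (x i)) :
    IsWeightDecayFlow (modelOutputs f x) (WithLp.toLp 2 y) (2 / n) lam θ₀ γ where
  init := hγ.1
  hasDerivWithinAt t ht := by
    simpa only [(hasGradientAt_regLoss hf).gradient] using hγ.2 t ht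

theorem exists_isGradientFlow_regLoss (hf : ∀ i, ContDiff ℝ 2 fun θ => f θ (x i)) (hlam : 0 < lam) :
    ∃ γ, IsGradientFlow (regLoss f x y lam) θ₀ γ := by
  refine exists_isGradientFlow_of_isBounded ?_ ?_
  · rw [funext (regLoss_eq_norm_sq f x y lam)]
    exact ((((contDiff_modelOutputs hf).sub contDiff_const).norm_sq ℝ).const_smul (1 / n : ℝ)).add
      ((contDiff_norm_sq ℝ).const_smul (lam / 2))
  · refine isBounded_iff_forall_norm_le.2
      ⟨√(2 / lam * regLoss f x y lam θ₀), fun θ hθ => Real.le_sqrt_of_sq_le ?_⟩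
    have hloss : 0 ≤ 1 / n * ‖modelOutputs f x θ - WithLp.toLp 2 y‖ ^ 2 := by positivity
    rw [Set.mem_ofPred_eq, regLoss_eq_norm_sq f x y lam θ] at hθ
    rw [div_mul_eq_mul_div, le_div_iff₀ hlam]
    linarith

end Model

section StoppingTime

variable {lam : ℝ → ℝ} {c : ℝ}

theorem decayScale_stoppingTime {α lam : ℝ} (hα : 0 < α) (hlam : lam ≠ 0) (c : ℝ) :
    decayScale α lam ((1 - c) / lam * Real.log α) = α ^ c := by
  have hexp : -(lam * ((1 - c) / lam * Real.log α)) = Real.log α * (c - 1) := by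
    field_simp; ring
  rw [decayScale, hexp, ← Real.rpow_def_of_pos hα, Real.rpow_sub_one hα.ne',
    mul_div_cancel₀ _ hα.ne']

theorem tendsto_stoppingTime (hlam_pos : ∀ α, 0 < α → 0 < lam α)
    (hlam : Tendsto lam atTop (𝓝 0)) (hc : c < 1) :
    Tendsto (fun α => (1 - c) / lam α * Real.log α) atTop atTop := by
  have hlam' : Tendsto lam atTop (𝓝[>] 0) := tendsto_nhdsWithin_iff.2
    ⟨hlam, (eventually_gt_atTop 0).mono hlam_pos⟩
  exact (hlam'.inv_tendsto_nhdsGT_zero.const_mul_atTop (sub_pos.2 hc)).atTop_mul_atTop₀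
    Real.tendsto_log_atTop

theorem isKernelRegime_stoppingTime {V W : Type*} [NormedAddCommGroup V] [InnerProductSpace ℝ V]
    [CompleteSpace V] [NormedAddCommGroup W] [InnerProductSpace ℝ W] [CompleteSpace W]
    {G : V → W} {y : W} {μ : ℝ} {θ₀ : V} {θ : ℝ → ℝ → V} (hμ : 0 < μ)
    (hlam_pos : ∀ α, 0 < α → 0 < lam α) (hlam : Tendsto lam atTop (𝓝 0))
    (hθ : ∀ α, 0 < α → IsWeightDecayFlow G y μ (lam α) (α • θ₀) (θ α)) (hc : 0 < c) (hc1 : c < 1) :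
    IsKernelRegime atTop G y μ θ₀ id lam (fun α => (1 - c) / lam α * Real.log α) θ where
  mu_pos := hμ
  eventually_isWeightDecayFlow := (eventually_gt_atTop 0).mono hθ
  eventually_lam_nonneg := (eventually_gt_atTop 0).mono fun α hα => (hlam_pos α hα).le
  tendsto_lam := hlam
  tendsto_time := tendsto_stoppingTime hlam_pos hlam hc1
  tendsto_decayScale := (tendsto_rpow_atTop hc).congr' <|
    (eventually_gt_atTop 0).mono fun α hα =>
      (decayScale_stoppingTime hα (hlam_pos α hα).ne' c).symm

end StoppingTime

theorem mainTheorem3_general {D n : ℕ} (hn : 0 < n) {X : Type*}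
    (f : EuclideanSpace ℝ (Fin D) → X → ℝ) (L : ℝ)
    (hhom : IsHomogeneousModel f L)
    (hsmooth : ∀ x : X, ContDiff ℝ 2 (fun θ => f θ x))
    (x : Fin n → X) (y : Fin n → ℝ)
    (θinit : EuclideanSpace ℝ (Fin D))
    (hzero : ∀ x' : X, f θinit x' = 0)
    (hindep : LinearIndependent ℝ (fun i => ntkFeature f θinit (x i)))
    (lam : ℝ → ℝ)
    (hlam_pos : ∀ α : ℝ, 0 < α → 0 < lam α)
    (hlam : Tendsto lam atTop (𝓝 0)) :
    (∃! h : EuclideanSpace ℝ (Fin D),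
        IsMinNormInterpolant (fun i => ntkFeature f θinit (x i)) y h) ∧
    (∀ α : ℝ, 0 < α → ∃ θ : ℝ → EuclideanSpace ℝ (Fin D),
        IsGradientFlow (regLoss f x y (lam α)) (α • θinit) θ) ∧
    (∀ h : EuclideanSpace ℝ (Fin D),
      IsMinNormInterpolant (fun i => ntkFeature f θinit (x i)) y h →
      ∀ θ : ℝ → ℝ → EuclideanSpace ℝ (Fin D),
        (∀ α : ℝ, 0 < α → IsGradientFlow (regLoss f x y (lam α)) (α • θinit) (θ α)) →
        ∀ c : ℝ, 0 < c → c < 1 → ∀ x' : X,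
          Tendsto (fun α : ℝ => f (θ α ((1 - c) / lam α * Real.log α)) x') atTop
            (𝓝 (inner ℝ (ntkFeature f θinit x') h))) := by
  have hdiff (x' : X) : Differentiable ℝ fun θ => f θ x' := (hsmooth x').differentiable two_ne_zero
  have hinit : IsKernelInitialization (modelOutputs f x) L θinit :=
    isKernelInitialization_modelOutputs hn hhom (fun i => (hsmooth (x i)).of_le one_le_two)
      (fun i => hzero (x i)) hindep
  obtain ⟨h₀, hh₀, hy⟩ := exists_mem_orthogonal_ker_map_eq hinit.surjective_fderiv
    (WithLp.toLp 2 y)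
  have hmin (h) : IsMinNormInterpolant (fun i => ntkFeature f θinit (x i)) y h ↔ h = h₀ :=
    isMinNormInterpolant_iff_eq (fderiv_modelOutputs_apply fun i => hdiff (x i)) hh₀ hy
  refine ⟨⟨h₀, (hmin h₀).2 rfl, fun h => (hmin h).1⟩,
    fun α hα => exists_isGradientFlow_regLoss (fun i => hsmooth (x i)) (hlam_pos α hα), ?_⟩
  intro h hh θ hθ c hc hc1 x'
  obtain rfl := (hmin h).1 hh
  have hreg : IsKernelRegime atTop (modelOutputs f x) (WithLp.toLp 2 y) (2 / n) θinit id lam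
      (fun α => (1 - c) / lam α * Real.log α) θ :=
    isKernelRegime_stoppingTime (by positivity) hlam_pos hlam
      (fun α hα => (hθ α hα).isWeightDecayFlow fun i => hdiff (x i)) hc hc1
  rw [← fderiv_apply_eq_inner_ntkFeature (hdiff x' θinit)]
  exact hreg.tendsto_map_of_isPosHomogeneous hinit hh₀ hy (fun c hc θ => hhom x' c hc θ)
    (hdiff x' θinit) (hzero x')

theorem mainTheorem3 {D n : ℕ} (hn : 0 < n) {X : Type*}
    (f : EuclideanSpace ℝ (Fin D) → X → ℝ) (L : ℝ)
    (hhom : IsHomogeneousModel f L)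
    (hsmooth : ∀ x : X, ContDiff ℝ 2 (fun θ => f θ x))
    (x : Fin n → X) (y : Fin n → ℝ)
    (θinit : EuclideanSpace ℝ (Fin D))
    (hzero : ∀ x' : X, f θinit x' = 0)
    (hindep : LinearIndependent ℝ (fun i => ntkFeature f θinit (x i)))
    (lam : ℝ → ℝ) (p : ℝ) (hp : 0 < p)
    (hlam_pos : ∀ α : ℝ, 0 < α → 0 < lam α)
    (hlam : lam =Θ[atTop] fun α : ℝ => α ^ (-p)) :
    (∃! h : EuclideanSpace ℝ (Fin D),
        IsMinNormInterpolant (fun i => ntkFeature f θinit (x i)) y h) ∧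
    (∀ α : ℝ, 0 < α → ∃ θ : ℝ → EuclideanSpace ℝ (Fin D),
        IsGradientFlow (regLoss f x y (lam α)) (α • θinit) θ) ∧
    (∀ h : EuclideanSpace ℝ (Fin D),
      IsMinNormInterpolant (fun i => ntkFeature f θinit (x i)) y h →
      ∀ θ : ℝ → ℝ → EuclideanSpace ℝ (Fin D),
        (∀ α : ℝ, 0 < α → IsGradientFlow (regLoss f x y (lam α)) (α • θinit) (θ α)) →
        ∀ c : ℝ, 0 < c → c < 1 → ∀ x' : X,
          Tendsto (fun α : ℝ => f (θ α ((1 - c) / lam α * Real.log α)) x') atTop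
            (𝓝 (inner ℝ (ntkFeature f θinit x') h))) :=
  mainTheorem3_general hn f L hhom hsmooth x y θinit hzero hindep lam hlam_pos
    (hlam.1.trans_tendsto (tendsto_rpow_neg_atTop hp))
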